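/- Let $d \ge 1$ be an integer and let $1 \le p < \infty$. For a box $I = [a_1,b_1]\times\dots\times[a_d,b_d]\subset\mathbb{R}^d$ and $B>0$ let $\mathcal{C}_p(I,B)$ be the class of all convex functions $f$ on $I$ with $\int_I |f(x)|^p\,dx \le B^p$. For a class $\mathcal{F}$ of functions and a box $J$, let $M(\mathcal{F},\epsilon;L_p(J))$ be the smallest number of closed balls of radius $\epsilon$ in $L_p(J)$ (that is, with respect to the pseudometric $(\int_J |f-g|^p\,dx)^{1/p}$) whose union contains $\mathcal{F}$, with value $\infty$ if no finite number suffices. There exists a constant $c>0$ depending only on $d$ and $p$ such that for all boxes $I = [a_1,b_1]\times\dots\times[a_d,b_d]$ and $J = [\alpha_1,\beta_1]\times\dots\times[\alpha_d,\beta_d]$ with $a_i<\alpha_i<\beta_i<b_i$ for $i=1,\dots,d$, all $B>0$ and all $\epsilon>0$, $$\log M(\mathcal{C}_p(I,B),\epsilon;L_p(J)) \le c\left(\frac{\epsilon}{B}\right)^{-d/2}\left(\log\frac1\eta\right)^{d(2p+d)/(2p)},$$ where $$\eta := \min_{1\le i\le d}\min\left(\frac{\alpha_i-a_i}{b_i-a_i},\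 \frac{b_i-\beta_i}{b_i-a_i}\right).$$ In particular, the left-hand side is finite. -/

import Mathlib

open MeasureTheory
open scoped ENNReal

/-- The class `C_p(I, B)`: real functions that are convex on `I` and satisfy
`∫_I |f(x)|^p dx ≤ B^p`. Values outside `I` are irrelevant. The lower Lebesgue integral is used, so
that a function with `∫_I |f|^p = ∞` is not in the class. -/
def convexClass {d : ℕ} (p : ℝ) (I : Set (Fin d → ℝ)) (B : ℝ) : Set ((Fin d → ℝ) → ℝ) :=
  {f | ConvexOn ℝ I f ∧
    ∫⁻ x in I, ENNReal.ofReal (|f x| ^ p) ≤ ENNReal.ofReal (B ^ p)}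

/-- `C` is an `ε`-net for `F` in the `L_p(J)` pseudometric: the closed `L_p(J)`-balls of radius `ε`
centred at the members of `C`, all of which lie in the space `L_p(J)`, cover `F`. -/
def IsLpCover {d : ℕ} (p : ℝ) (J : Set (Fin d → ℝ)) (F : Set ((Fin d → ℝ) → ℝ)) (ε : ℝ)
    (C : Set ((Fin d → ℝ) → ℝ)) : Prop :=
  (∀ g ∈ C, MemLp g (ENNReal.ofReal p) (volume.restrict J)) ∧
  ∀ f ∈ F, ∃ g ∈ C,
    eLpNorm (f - g) (ENNReal.ofReal p) (volume.restrict J) ≤ ENNReal.ofReal ε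

/-- The covering number `M(F, ε; L_p(J))`: the smallest number of closed balls of radius `ε` in
`L_p(J)` whose union contains `F` (`⊤` if there is no finite cover). -/
noncomputable def lpCoveringNumber {d : ℕ} (F : Set ((Fin d → ℝ) → ℝ)) (ε p : ℝ)
    (J : Set (Fin d → ℝ)) : ℕ∞ :=
  ⨅ (C : Set ((Fin d → ℝ) → ℝ)) (_ : IsLpCover p J F ε C), C.encard

/-- The metric entropy `log M(F, ε; L_p(J))`, with `log ∞ = ∞`. -/
noncomputable def lpMetricEntropy {d : ℕ} (F : Set ((Fin d → ℝ) → ℝ)) (ε p : ℝ)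
    (J : Set (Fin d → ℝ)) : EReal :=
  ENNReal.log (lpCoveringNumber F ε p J : ℝ≥0∞)

/-- The minimal relative distance, over all coordinates and both sides, from the box `[α, β]` to the
boundary of the box `[a, b]` (a minimum over a finite set, non-empty for `d ≥ 1`). -/
noncomputable def relDist {d : ℕ} (a b α β : Fin d → ℝ) : ℝ :=
  ⨅ i, min ((α i - a i) / (b i - a i)) ((b i - β i) / (b i - a i))

/-! The box `J` is covered by `(2m)^d` dyadic boxes, with `m` of order `log (1/η)`, whose triples
lie in `I`. On the triple of a box of volume `V`, the bound on the integral forces `|f| ≤ A`, with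
`A` a constant times `B * V^(-1/p)`, on the concentric double (`abs_le_of_lintegral_le`). Rescaling
thus reduces the problem to convex functions bounded by one on a cube larger than the unit cube, to
be approximated uniformly on the unit cube.

For these, log-cardinality of order `δ^(-d)` at accuracy `δ^2` (`exists_convex_code`) comes from the
Moreau envelope. It is convex, and subtracting `|z|^2 / 2` makes it concave, so its second
differences on a grid of spacing `δ` lie in `[0, δ^2]`. Rounded to multiples of `δ^2`, the envelope
is therefore described by boundedly many choices per grid point, plus initial values on `{0,1}^d`.
The envelope near `x + ξ`, with `ξ` an approximate subgradient at `x`, gives back `h x` up to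
`O(δ^2)`.

The accuracy on each box is chosen so that all `n = (2m)^d` boxes contribute equally to the error
`ε^p`. The log-cardinality is then of order `n * (n^(-1/p) * ε / B)^(-d/2)`, and `n^(1 + d/(2p))`
gives the power of the logarithm. -/

/-! ### Normalized convex functions and their slopes. -/

/-- Convex functions on the cube `[-1/2, 3/2]^d` that are continuous and bounded by one there. -/
def IsNormalizedConvex {d : ℕ} (h : (Fin d → ℝ) → ℝ) : Prop :=
  ConvexOn ℝ (Set.Icc (fun _ => -1 / 2) (fun _ => 3 / 2)) h ∧
  ContinuousOn h (Set.Icc (fun _ => -1 / 2) (fun _ => 3 / 2)) ∧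
  ∀ x ∈ Set.Icc (fun _ : Fin d => (-1 / 2 : ℝ)) (fun _ => 3 / 2), |h x| ≤ 1

lemma unitCube_subset {d : ℕ} :
    Set.Icc (0 : Fin d → ℝ) 1 ⊆ Set.Icc (fun _ => -1 / 2) (fun _ => 3 / 2) := by
  rintro x ⟨h0, h1⟩
  refine ⟨fun i => ?_, fun i => ?_⟩
  · have := h0 i
    simp only [Pi.zero_apply] at this
    linarith
  · have := h1 i
    simp only [Pi.one_apply] at this
    linarith

/-- An affine minorant that is `θ`-close at `x`, with bounded slope. -/
lemma IsNormalizedConvex.exists_slope {d : ℕ} {h : (Fin d → ℝ) → ℝ} (hh : IsNormalizedConvex h)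
    {x : Fin d → ℝ} (hx : x ∈ Set.Icc (0 : Fin d → ℝ) 1) {θ : ℝ} (hθ : 0 < θ) (hθ1 : θ ≤ 1) :
    ∃ ξ : Fin d → ℝ, (∀ i, |ξ i| ≤ 6) ∧
      ∀ y ∈ Set.Icc (0 : Fin d → ℝ) 1, h x - θ + ∑ i, ξ i * (y i - x i) ≤ h y := by
  obtain ⟨hc, hcont, hb⟩ := hh
  -- The loss `θ` allows strict separation from the epigraph; it will be `δ ^ 2`, the order of the
  -- other errors.
  obtain ⟨l, c, hle, heq⟩ := ConvexOn.exists_affine_le_of_lt (𝕜 := ℝ) (a := h x - θ)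
    (unitCube_subset hx) (by linarith) isClosed_Icc hcont.lowerSemicontinuousOn hc
  have hle' : ∀ y ∈ Set.Icc (fun _ : Fin d => (-1 / 2 : ℝ)) (fun _ => 3 / 2), l y + c ≤ h y :=
    fun y hy => by simpa using hle ⟨y, hy⟩
  have heq' : l x + c = h x - θ := by simpa using heq
  have hmem : ∀ i, ∀ t : ℝ, |t| ≤ 1 / 2 →
      x + t • (Pi.single i (1 : ℝ) : Fin d → ℝ) ∈
        Set.Icc (fun _ : Fin d => (-1 / 2 : ℝ)) (fun _ => 3 / 2) := by
    intro i t ht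
    have ht' := abs_le.1 ht
    constructor <;> intro j <;> have h0 := hx.1 j <;> have h1 := hx.2 j <;>
      by_cases hij : j = i <;> simp [hij] at h0 h1 ⊢ <;> try subst hij
    all_goals linarith
  -- The minorant is at most `1` at the shifted point and at least `-1 - θ ≥ -2` at `x`; steps
  -- `±1/2` then bound the slope by `6`.
  have hslope : ∀ i, ∀ t : ℝ, |t| ≤ 1 / 2 → t * l (Pi.single i 1) ≤ 3 := by
    intro i t ht
    have h1 := hle' _ (hmem i t ht)
    have h2 := (abs_le.1 (hb _ (hmem i t ht))).2
    have h3 := (abs_le.1 (hb _ (unitCube_subset hx))).1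
    rw [map_add, map_smul, smul_eq_mul] at h1
    linarith
  refine ⟨fun i => l (Pi.single i 1), fun i => ?_, fun y hy => ?_⟩
  · have h1 := hslope i (1 / 2) (by norm_num)
    have h2 := hslope i (-1 / 2) (by norm_num)
    rw [abs_le]
    constructor <;> linarith
  · have h1 := hle' _ (unitCube_subset hy)
    have h2 : ∑ i, l (Pi.single i 1) * (y i - x i) = l (y - x) := by
      conv_rhs => rw [pi_eq_sum_univ' (y - x), map_sum]
      refine Finset.sum_congr rfl fun i _ => ?_
      rw [map_smul, smul_eq_mul, mul_comm]
      rfl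
    rw [h2, map_sub]
    linarith

/-! ### The Moreau envelope and recovery of the function from it. -/

/-- The Moreau envelope of a function on the unit cube. -/
noncomputable def moreauEnv {d : ℕ} (h : (Fin d → ℝ) → ℝ) (z : Fin d → ℝ) : ℝ :=
  ⨅ y : Set.Icc (0 : Fin d → ℝ) 1, (h y + (∑ i, ((y : Fin d → ℝ) i - z i) ^ 2) / 2)

section Moreau

variable {d : ℕ} {h h' : (Fin d → ℝ) → ℝ}

lemma IsNormalizedConvex.abs_le (hh : IsNormalizedConvex h) {y : Fin d → ℝ}
    (hy : y ∈ Set.Icc (0 : Fin d → ℝ) 1) : |h y| ≤ 1 :=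
  hh.2.2 y (unitCube_subset hy)

lemma moreauEnv_le (hh : IsNormalizedConvex h) (z : Fin d → ℝ) {y : Fin d → ℝ}
    (hy : y ∈ Set.Icc (0 : Fin d → ℝ) 1) :
    moreauEnv h z ≤ h y + (∑ i, (y i - z i) ^ 2) / 2 := by
  refine ciInf_le (f := fun y : Set.Icc (0 : Fin d → ℝ) 1 =>
    h y + (∑ i, ((y : Fin d → ℝ) i - z i) ^ 2) / 2) ⟨-1, ?_⟩ ⟨y, hy⟩
  rintro _ ⟨⟨w, hw⟩, rfl⟩
  have h1 := (_root_.abs_le.1 (hh.abs_le hw)).1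
  have h2 : 0 ≤ ∑ i, (w i - z i) ^ 2 := Finset.sum_nonneg fun i _ => sq_nonneg _
  simp only
  linarith

lemma zero_mem_unitCube : (0 : Fin d → ℝ) ∈ Set.Icc (0 : Fin d → ℝ) 1 :=
  ⟨le_rfl, fun _ => zero_le_one⟩

lemma le_moreauEnv {z : Fin d → ℝ} {r : ℝ}
    (hr : ∀ y ∈ Set.Icc (0 : Fin d → ℝ) 1, r ≤ h y + (∑ i, (y i - z i) ^ 2) / 2) :
    r ≤ moreauEnv h z := by
  have : Nonempty (Set.Icc (0 : Fin d → ℝ) 1) := ⟨⟨0, zero_mem_unitCube⟩⟩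
  exact le_ciInf fun y => hr y y.2

/-- Semiconcavity: the envelope minus `|z|^2 / 2` is an infimum of affine functions of `z`.
Convexity of `h` plays no role. -/
lemma moreauEnv_add_le (hh : IsNormalizedConvex h) (z s : Fin d → ℝ) :
    moreauEnv h (z + s) + moreauEnv h (z - s) ≤ 2 * moreauEnv h z + ∑ i, s i ^ 2 := by
  suffices (moreauEnv h (z + s) + moreauEnv h (z - s) - ∑ i, s i ^ 2) / 2 ≤ moreauEnv h z by
    linarith
  refine le_moreauEnv fun y hy => ?_
  have h1 := moreauEnv_le hh (z + s) hy
  have h2 := moreauEnv_le hh (z - s) hy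
  have h3 : ∑ i, (y i - (z + s) i) ^ 2 + ∑ i, (y i - (z - s) i) ^ 2 =
      2 * ∑ i, (y i - z i) ^ 2 + 2 * ∑ i, s i ^ 2 := by
    rw [← Finset.sum_add_distrib, Finset.mul_sum, Finset.mul_sum, ← Finset.sum_add_distrib]
    refine Finset.sum_congr rfl fun i _ => ?_
    simp only [Pi.add_apply, Pi.sub_apply]
    ring
  linarith

/-- Convexity: the envelope is the partial infimum over `y` of a function jointly convex in `(y,
z)`. The midpoint of two competitors is a competitor at `z`. -/
lemma two_mul_moreauEnv_le (hh : IsNormalizedConvex h) (z s : Fin d → ℝ) :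
    2 * moreauEnv h z ≤ moreauEnv h (z + s) + moreauEnv h (z - s) := by
  suffices 2 * moreauEnv h z - moreauEnv h (z - s) ≤ moreauEnv h (z + s) by linarith
  refine le_moreauEnv fun y hy => ?_
  suffices 2 * moreauEnv h z - (h y + (∑ i, (y i - (z + s) i) ^ 2) / 2) ≤
    moreauEnv h (z - s) by linarith
  refine le_moreauEnv fun w hw => ?_
  have hmid := hh.1.2 (unitCube_subset hy) (unitCube_subset hw)
    (by norm_num : (0 : ℝ) ≤ 1 / 2) (by norm_num : (0 : ℝ) ≤ 1 / 2) (by norm_num)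
  have hv : ((1 / 2 : ℝ) • y + (1 / 2 : ℝ) • w) ∈ Set.Icc (0 : Fin d → ℝ) 1 :=
    convex_Icc (𝕜 := ℝ) 0 1 hy hw (by norm_num) (by norm_num) (by norm_num)
  have h1 := moreauEnv_le hh z hv
  have h2 : 2 * ∑ i, (((1 / 2 : ℝ) • y + (1 / 2 : ℝ) • w) i - z i) ^ 2 ≤
      ∑ i, (y i - (z + s) i) ^ 2 + ∑ i, (w i - (z - s) i) ^ 2 := by
    rw [← Finset.sum_add_distrib, Finset.mul_sum]
    refine Finset.sum_le_sum fun i _ => ?_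
    simp only [Pi.add_apply, Pi.sub_apply, Pi.smul_apply, smul_eq_mul]
    nlinarith [sq_nonneg (y i - (z i + s i) - (w i - (z i - s i)))]
  simp only [smul_eq_mul] at hmid
  linarith

lemma abs_moreauEnv_le (hh : IsNormalizedConvex h) {z : Fin d → ℝ}
    (hz : ∀ i, |z i| ≤ 9) : |moreauEnv h z| ≤ 1 + 41 * d := by
  rw [_root_.abs_le]
  constructor
  · refine le_moreauEnv fun y hy => ?_
    have h1 := (_root_.abs_le.1 (hh.abs_le hy)).1
    have h2 : 0 ≤ ∑ i, (y i - z i) ^ 2 := Finset.sum_nonneg fun i _ => sq_nonneg _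
    have h3 : (0 : ℝ) ≤ d := Nat.cast_nonneg d
    linarith
  · refine (moreauEnv_le hh z zero_mem_unitCube).trans ?_
    have h1 := (_root_.abs_le.1 (hh.abs_le zero_mem_unitCube)).2
    have h2 : ∑ i, ((0 : Fin d → ℝ) i - z i) ^ 2 ≤ ∑ _i : Fin d, (81 : ℝ) := by
      refine Finset.sum_le_sum fun i _ => ?_
      have := _root_.abs_le.1 (hz i)
      simp only [Pi.zero_apply]
      nlinarith
    simp only [Finset.sum_const, Finset.card_univ, Fintype.card_fin, nsmul_eq_mul] at h2
    linarith

/-- For `z = x + ξ` the point `y = x` minimizes the quadratic problem with `h` replaced by its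
affine minorant; completing the square shows that moving `z` by `δ` per coordinate costs at most `d
* δ^2 / 2`. -/
lemma le_moreauEnv_of_slope {x ξ z : Fin d → ℝ} {θ δ : ℝ}
    (hξ : ∀ y ∈ Set.Icc (0 : Fin d → ℝ) 1, h x - θ + ∑ i, ξ i * (y i - x i) ≤ h y)
    (hz : ∀ i, |x i + ξ i - z i| ≤ δ) :
    h x - θ - d * δ ^ 2 / 2 + (∑ i, (x i - z i) ^ 2) / 2 ≤ moreauEnv h z := by
  refine le_moreauEnv fun y hy => ?_
  have h1 := hξ y hy
  have h2 : ∑ i, (x i - z i) ^ 2 ≤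
      ∑ i, (2 * (ξ i * (y i - x i)) + (y i - z i) ^ 2 + δ ^ 2) := by
    refine Finset.sum_le_sum fun i _ => ?_
    have h3 : (x i + ξ i - z i) ^ 2 ≤ δ ^ 2 := sq_le_sq' (_root_.abs_le.1 (hz i)).1
      (_root_.abs_le.1 (hz i)).2
    nlinarith [sq_nonneg (y i - x i + (x i + ξ i - z i))]
  rw [Finset.sum_add_distrib, Finset.sum_add_distrib, ← Finset.mul_sum] at h2
  simp only [Finset.sum_const, Finset.card_univ, Fintype.card_fin, nsmul_eq_mul] at h2
  linarith

/-- The grid with spacing `δ` and lowest corner `(-6, …, -6)`. -/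
def gridPoint (δ : ℝ) (k : Fin d → ℕ) : Fin d → ℝ := fun i => -6 + δ * k i

lemma exists_gridPoint_near {δ : ℝ} (hδ : 0 < δ) {N : ℕ} (hN : 13 < δ * N) {w : Fin d → ℝ}
    (hw : ∀ i, -6 ≤ w i ∧ w i ≤ 7) :
    ∃ k : Fin d → ℕ, (∀ i, k i < N) ∧ ∀ i, |w i - gridPoint δ k i| ≤ δ := by
  have h0 : ∀ i, 0 ≤ (w i + 6) / δ := fun i => div_nonneg (by linarith [(hw i).1]) hδ.le
  refine ⟨fun i => ⌊(w i + 6) / δ⌋₊, fun i => ?_, fun i => ?_⟩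
  · rw [Nat.floor_lt (h0 i), div_lt_iff₀ hδ]
    linarith [(hw i).2]
  · have h1 := Nat.floor_le (h0 i)
    have h2 := Nat.lt_floor_add_one ((w i + 6) / δ)
    rw [le_div_iff₀ hδ] at h1
    rw [div_lt_iff₀ hδ] at h2
    simp only [gridPoint]
    rw [_root_.abs_le]
    constructor <;> nlinarith

/-- At a grid point `z` near `x + ξ`, the envelope of `h` is almost `h x + |x - z|^2 / 2`, while
that of `h'` is at most `h' x + |x - z|^2 / 2`. The quadratic terms cancel. -/
lemma le_add_of_moreauEnv_le (hh : IsNormalizedConvex h) (hh' : IsNormalizedConvex h')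
    {δ : ℝ} (hδ : 0 < δ) (hδ1 : δ ≤ 1) {N : ℕ} (hN : 13 < δ * N)
    (henv : ∀ k : Fin d → ℕ, (∀ i, k i < N) →
      moreauEnv h (gridPoint δ k) ≤ moreauEnv h' (gridPoint δ k) + δ ^ 2)
    {x : Fin d → ℝ} (hx : x ∈ Set.Icc (0 : Fin d → ℝ) 1) :
    h x ≤ h' x + (d + 2) * δ ^ 2 := by
  obtain ⟨ξ, hξ6, hξ⟩ := hh.exists_slope hx (θ := δ ^ 2) (by positivity)
    (pow_le_one₀ hδ.le hδ1)
  -- Since `x i ∈ [0, 1]` and `|ξ i| ≤ 6`, the target lies in `[-6, 7]^d`, which fixes the corner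
  -- `-6` and the side `13` of the grid.
  obtain ⟨k, hk, hkδ⟩ := exists_gridPoint_near hδ hN (w := fun i => x i + ξ i) fun i => by
    have h0 := hx.1 i
    have h1 := hx.2 i
    have h2 := _root_.abs_le.1 (hξ6 i)
    simp only [Pi.zero_apply, Pi.one_apply] at h0 h1
    constructor <;> linarith
  have h1 := le_moreauEnv_of_slope hξ hkδ
  have h2 := moreauEnv_le hh' (gridPoint δ k) hx
  have h3 := henv k hk
  have h4 : 0 ≤ d * δ ^ 2 := by positivity
  linarith

end Moreau

/-! ### Reconstruction from second differences, and counting. -/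

section SecondDifference

variable {d : ℕ}

/-- The second differences of a function on the grid, each taken in one coordinate direction that
allows it; at the points of `{0, 1}^d`, where none does, the value itself. -/
noncomputable def secondDifference (G : (Fin d → ℕ) → ℤ) (k : Fin d → ℕ) : ℤ :=
  open Classical in
  if hk : ∃ i, 2 ≤ k i then
    G k - 2 * G (Function.update k hk.choose (k hk.choose - 1)) +
      G (Function.update k hk.choose (k hk.choose - 2))
  else G k

/-- The second difference at `k` expresses `G k` through two points with smaller coordinate sum, so
induction on that sum recovers `G`. The chosen direction depends on `k` alone, hence is the same for
`G` and `G'`. -/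
lemma eq_of_secondDifference_eq {G G' : (Fin d → ℕ) → ℤ} {N : ℕ}
    (hG : ∀ k : Fin d → ℕ, (∀ i, k i < N) → secondDifference G k = secondDifference G' k)
    (k : Fin d → ℕ) (hk : ∀ i, k i < N) : G k = G' k := by
  induction hn : ∑ i, k i using Nat.strong_induction_on generalizing k with
  | _ n ih =>
    have hstep : ∀ i, 2 ≤ k i → ∀ j, 1 ≤ j →
        G (Function.update k i (k i - j)) = G' (Function.update k i (k i - j)) := by
      intro i hi j hj
      refine ih _ ?_ (Function.update k i (k i - j)) (fun l => ?_) rfl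
      · rw [← hn]
        refine Finset.sum_lt_sum (fun l _ => ?_) ⟨i, Finset.mem_univ _, ?_⟩
        · by_cases hl : l = i
          · subst hl
            simp
          · simp [Function.update_of_ne hl]
        · simp only [Function.update_self]
          omega
      · by_cases hl : l = i
        · subst hl
          simp only [Function.update_self]
          have := hk l
          omega
        · rw [Function.update_of_ne hl]
          exact hk l
    have h1 := hG k hk
    unfold secondDifference at h1
    split_ifs at h1 with hex
    · rw [hstep _ hex.choose_spec 1 le_rfl, hstep _ hex.choose_spec 2 (by norm_num)] at h1
      linarith
    · exact h1

open Classical in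
lemma card_filter_lt_two_le (N : ℕ) :
    ((Finset.univ : Finset (Fin d → Fin N)).filter (fun k => ¬ ∃ i, 2 ≤ (k i : ℕ))).card
      ≤ 2 ^ d := by
  have hsub : (Finset.univ : Finset (Fin d → Fin N)).filter (fun k => ¬ ∃ i, 2 ≤ (k i : ℕ)) ⊆
      Fintype.piFinset fun _ => (Finset.univ : Finset (Fin N)).filter fun j => (j : ℕ) < 2 := by
    intro k hk
    simp only [Finset.mem_filter, Finset.mem_univ, true_and, not_exists, not_le] at hk
    simpa [Fintype.mem_piFinset] using hk
  refine (Finset.card_le_card hsub).trans ?_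
  rw [Fintype.card_piFinset, Finset.prod_const, Finset.card_univ, Fintype.card_fin]
  refine Nat.pow_le_pow_left ?_ d
  calc _ = (((Finset.univ : Finset (Fin N)).filter fun j : Fin N => (j : ℕ) < 2).map
          Fin.valEmbedding).card := (Finset.card_map _).symm
    _ ≤ (Finset.range 2).card := by
        refine Finset.card_le_card fun j hj => ?_
        simp only [Finset.mem_map, Finset.mem_filter] at hj
        obtain ⟨l, ⟨_, hl⟩, rfl⟩ := hj
        exact Finset.mem_range.2 hl
    _ = 2 := Finset.card_range 2

/-- The possible second differences of integer functions on the grid that are bounded by `M` on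
`{0, 1}^d` and have second differences between `-2` and `3`. -/
noncomputable def codeSet (d N : ℕ) (M : ℕ) : Finset ((Fin d → Fin N) → ℤ) :=
  open Classical in
  Fintype.piFinset fun k =>
    if ∃ i, 2 ≤ (k i : ℕ) then Finset.Icc (-2) 3 else Finset.Icc (-(M : ℤ)) M

lemma card_codeSet_le (d N M : ℕ) :
    (codeSet d N M).card ≤ 6 ^ (N ^ d) * (2 * M + 1) ^ (2 ^ d) := by
  classical
  unfold codeSet
  rw [Fintype.card_piFinset]
  have h1 : ∀ k : Fin d → Fin N, (if ∃ i, 2 ≤ (k i : ℕ) then Finset.Icc (-2 : ℤ) 3 else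
      Finset.Icc (-(M : ℤ)) M).card = if ∃ i, 2 ≤ (k i : ℕ) then 6 else 2 * M + 1 := by
    intro k
    split_ifs
    · rfl
    · rw [Int.card_Icc]
      omega
  rw [Finset.prod_congr rfl fun k _ => h1 k, Finset.prod_ite, Finset.prod_const,
    Finset.prod_const]
  refine Nat.mul_le_mul (Nat.pow_le_pow_right (by norm_num) ?_)
    (Nat.pow_le_pow_right (by omega) (card_filter_lt_two_le N))
  refine (Finset.card_filter_le _ _).trans ?_
  simp [Finset.card_univ]

end SecondDifference

/-! ### The quantized envelope as a code. -/

section Quantized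

variable {d : ℕ} {h h' : (Fin d → ℝ) → ℝ}

/-- The Moreau envelope on the grid, in units of `δ ^ 2`, rounded down. -/
noncomputable def quantizedEnv (δ : ℝ) (h : (Fin d → ℝ) → ℝ) (k : Fin d → ℕ) : ℤ :=
  ⌊moreauEnv h (gridPoint δ k) / δ ^ 2⌋

lemma moreauEnv_le_of_quantizedEnv_eq {δ : ℝ} (hδ : 0 < δ) {k : Fin d → ℕ}
    (hk : quantizedEnv δ h k = quantizedEnv δ h' k) :
    moreauEnv h (gridPoint δ k) ≤ moreauEnv h' (gridPoint δ k) + δ ^ 2 := by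
  have h1 := Int.lt_floor_add_one (moreauEnv h (gridPoint δ k) / δ ^ 2)
  have h2 := Int.floor_le (moreauEnv h' (gridPoint δ k) / δ ^ 2)
  unfold quantizedEnv at hk
  rw [hk, div_lt_iff₀ (by positivity)] at h1
  rw [le_div_iff₀ (by positivity)] at h2
  linarith

lemma abs_quantizedEnv_le (hh : IsNormalizedConvex h) {δ : ℝ} (hδ : 0 < δ) {k : Fin d → ℕ}
    (hk : ∀ i, δ * k i ≤ 15) :
    |quantizedEnv δ h k| ≤ (⌈(1 + 41 * d) / δ ^ 2⌉₊ : ℤ) := by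
  have h1 : |moreauEnv h (gridPoint δ k)| ≤ 1 + 41 * d := by
    refine abs_moreauEnv_le hh fun i => ?_
    have h2 : 0 ≤ δ * k i := by positivity
    simp only [gridPoint]
    rw [abs_le]
    constructor <;> linarith [hk i]
  have h3 : |moreauEnv h (gridPoint δ k) / δ ^ 2| ≤ ⌈(1 + 41 * d) / δ ^ 2⌉₊ := by
    rw [abs_div, abs_of_pos (by positivity : 0 < δ ^ 2)]
    exact (div_le_div_of_nonneg_right h1 (by positivity)).trans (Nat.le_ceil _)
  rw [abs_le] at h3 ⊢
  constructor
  · refine Int.le_floor.2 ?_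
    push_cast
    exact h3.1
  · have := (Int.floor_le _).trans h3.2
    exact_mod_cast this

/-- Before rounding, the second difference in units of `δ ^ 2` is in `[0, 1]`; the two outer floors
lower it by less than `2` and the doubled middle one raises it by at most `2`. -/
lemma secondDifference_quantizedEnv_mem (hh : IsNormalizedConvex h) {δ : ℝ} (hδ : 0 < δ)
    {k : Fin d → ℕ} (hk : ∃ i, 2 ≤ k i) :
    secondDifference (quantizedEnv δ h) k ∈ Finset.Icc (-2 : ℤ) 3 := by
  unfold secondDifference
  rw [dif_pos hk]
  set i := hk.choose
  have hi : 2 ≤ k i := hk.choose_spec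
  set k₁ := Function.update k i (k i - 1)
  set k₂ := Function.update k i (k i - 2)
  set s : Fin d → ℝ := Pi.single i δ
  have e0 : gridPoint δ k = gridPoint δ k₁ + s := by
    ext j
    by_cases hj : j = i
    · subst hj
      simp only [gridPoint, k₁, s, Pi.add_apply, Function.update_self, Pi.single_eq_same]
      rw [Nat.cast_sub (by omega)]
      push_cast
      ring
    · simp [gridPoint, k₁, s, hj]
  have e2 : gridPoint δ k₂ = gridPoint δ k₁ - s := by
    ext j
    by_cases hj : j = i
    · subst hj
      simp only [gridPoint, k₁, k₂, s, Pi.sub_apply, Function.update_self, Pi.single_eq_same]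
      rw [Nat.cast_sub (by omega), Nat.cast_sub (by omega)]
      push_cast
      ring
    · simp [gridPoint, k₁, k₂, s, hj]
  have hs : ∑ j, s j ^ 2 = δ ^ 2 := by
    rw [Finset.sum_eq_single i]
    · simp [s]
    · intro j _ hj
      simp [s, hj]
    · simp
  have u1 := moreauEnv_add_le hh (gridPoint δ k₁) s
  have u2 := two_mul_moreauEnv_le hh (gridPoint δ k₁) s
  rw [← e0, ← e2, hs] at u1
  rw [← e0, ← e2] at u2
  have hδ2 : 0 < δ ^ 2 := by positivity
  have v1 : moreauEnv h (gridPoint δ k) / δ ^ 2 + moreauEnv h (gridPoint δ k₂) / δ ^ 2 ≤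
      2 * (moreauEnv h (gridPoint δ k₁) / δ ^ 2) + 1 := by
    rw [← add_div, ← mul_div_assoc, div_add_one hδ2.ne']
    exact div_le_div_of_nonneg_right u1 hδ2.le
  have v2 : 2 * (moreauEnv h (gridPoint δ k₁) / δ ^ 2) ≤
      moreauEnv h (gridPoint δ k) / δ ^ 2 + moreauEnv h (gridPoint δ k₂) / δ ^ 2 := by
    rw [← add_div, ← mul_div_assoc]
    exact div_le_div_of_nonneg_right u2 hδ2.le
  have f0 := Int.floor_le (moreauEnv h (gridPoint δ k) / δ ^ 2)
  have f0' := Int.lt_floor_add_one (moreauEnv h (gridPoint δ k) / δ ^ 2)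
  have f1 := Int.floor_le (moreauEnv h (gridPoint δ k₁) / δ ^ 2)
  have f1' := Int.lt_floor_add_one (moreauEnv h (gridPoint δ k₁) / δ ^ 2)
  have f2 := Int.floor_le (moreauEnv h (gridPoint δ k₂) / δ ^ 2)
  have f2' := Int.lt_floor_add_one (moreauEnv h (gridPoint δ k₂) / δ ^ 2)
  rw [Finset.mem_Icc]
  unfold quantizedEnv
  constructor
  · have : (-2 : ℝ) ≤ ((⌊moreauEnv h (gridPoint δ k) / δ ^ 2⌋ -
        2 * ⌊moreauEnv h (gridPoint δ k₁) / δ ^ 2⌋ +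
        ⌊moreauEnv h (gridPoint δ k₂) / δ ^ 2⌋ : ℤ) : ℝ) := by
      push_cast
      linarith
    exact_mod_cast this
  · have : ((⌊moreauEnv h (gridPoint δ k) / δ ^ 2⌋ -
        2 * ⌊moreauEnv h (gridPoint δ k₁) / δ ^ 2⌋ +
        ⌊moreauEnv h (gridPoint δ k₂) / δ ^ 2⌋ : ℤ) : ℝ) ≤ 3 := by
      push_cast
      linarith
    exact_mod_cast this

/-- Normalized convex functions are determined up to `(d + 2) δ ^ 2` on the unit cube by a code
with at most `exp (C δ⁻ᵈ)` values. -/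
theorem exists_convex_code {d : ℕ} (hd : 1 ≤ d) : ∃ C : ℝ, 0 < C ∧ ∀ δ : ℝ, 0 < δ → δ ≤ 1 →
    ∃ (γ : Type) (T : Finset γ) (code : ((Fin d → ℝ) → ℝ) → γ),
      (T.card : ℝ) ≤ Real.exp (C * (1 / δ) ^ d) ∧
      (∀ h, IsNormalizedConvex h → code h ∈ T) ∧
      ∀ h h', IsNormalizedConvex h → IsNormalizedConvex h' → code h = code h' →
        ∀ x ∈ Set.Icc (0 : Fin d → ℝ) 1, |h x - h' x| ≤ (d + 2) * δ ^ 2 := by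
  set K : ℝ := 2 * (1 + 41 * d) + 3 with hK
  have hK1 : 1 ≤ K := by
    have : (0 : ℝ) ≤ d := Nat.cast_nonneg d
    linarith
  refine ⟨2 * 15 ^ d + 2 ^ d * (2 * K), by positivity, fun δ hδ hδ1 => ?_⟩
  -- The grid must have `13 < δ * N` to reach across `[-6, 7]`; `14` leaves room, and `δ * N ≤ 15`
  -- keeps it inside `[-6, 9]^d`, where the envelope is at most `1 + 41 * d` in absolute value.
  set N := ⌈14 / δ⌉₊ with hN
  set M := ⌈(1 + 41 * d) / δ ^ 2⌉₊ with hM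
  have h1δ : 1 ≤ 1 / δ := by rwa [le_div_iff₀ hδ, one_mul]
  have hNle : (N : ℝ) ≤ 15 * (1 / δ) := by
    have := (Nat.ceil_lt_add_one (by positivity : 0 ≤ 14 / δ)).le
    rw [← hN] at this
    calc (N : ℝ) ≤ 14 / δ + 1 := this
      _ ≤ 14 / δ + 1 / δ := by linarith
      _ = 15 * (1 / δ) := by ring
  have hN13 : 13 < δ * N := by
    have := Nat.le_ceil (14 / δ)
    rw [← hN, div_le_iff₀ hδ] at this
    linarith
  have hgrid : ∀ k : Fin d → ℕ, (∀ i, k i < N) → ∀ i, δ * k i ≤ 15 := by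
    intro k hk i
    have h1 : (k i : ℝ) ≤ N := by exact_mod_cast (hk i).le
    calc δ * k i ≤ δ * (15 * (1 / δ)) := by gcongr; exact h1.trans hNle
      _ = 15 := by field_simp
  refine ⟨_, codeSet d N M, fun h k => secondDifference (quantizedEnv δ h) fun i => k i,
    ?_, fun h hh => ?_, fun h h' hh hh' heq x hx => ?_⟩
  -- The initial values cost only a logarithm of `1/δ`, bounded crudely by a multiple of `1/δ`; this
  -- is at most `(1/δ)^d` because `d ≥ 1`.
  · have hlog : Real.log (2 * M + 1) ≤ 2 * K * (1 / δ) ^ d := by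
      have hM1 : (2 * M + 1 : ℝ) ≤ (K * (1 / δ)) ^ 2 := by
        have h1 := (Nat.ceil_lt_add_one (by positivity : 0 ≤ (1 + 41 * d) / δ ^ 2)).le
        rw [← hM] at h1
        have h2 : 1 ≤ (1 / δ) ^ 2 := one_le_pow₀ h1δ
        calc (2 * M + 1 : ℝ) ≤ 2 * (1 + 41 * d) * (1 / δ) ^ 2 + 3 * 1 := by
              have h3 : (1 + 41 * (d : ℝ)) / δ ^ 2 = (1 + 41 * d) * (1 / δ) ^ 2 := by
                field_simp
              rw [h3] at h1
              linarith
          _ ≤ K * (1 / δ) ^ 2 := by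
              rw [hK]
              linarith
          _ ≤ K ^ 2 * (1 / δ) ^ 2 := by
              gcongr
              nlinarith
          _ = (K * (1 / δ)) ^ 2 := by ring
      have hpos : 0 < K * (1 / δ) := by positivity
      calc Real.log (2 * M + 1) ≤ Real.log ((K * (1 / δ)) ^ 2) :=
            Real.log_le_log (by positivity) hM1
        _ = 2 * Real.log (K * (1 / δ)) := by
            rw [Real.log_pow]
            norm_num
        _ ≤ 2 * (K * (1 / δ)) := by
            have := Real.log_le_sub_one_of_pos hpos
            linarith
        _ ≤ 2 * (K * (1 / δ) ^ d) := by
            gcongr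
            exact le_self_pow₀ h1δ (by omega)
        _ = 2 * K * (1 / δ) ^ d := by ring
    have h6 : (6 : ℝ) ≤ Real.exp 2 := by
      have h7 := Real.exp_one_gt_d9
      have h8 : Real.exp 2 = Real.exp 1 * Real.exp 1 := by
        rw [← Real.exp_add]
        norm_num
      rw [h8]
      nlinarith
    have hcard := card_codeSet_le d N M
    calc ((codeSet d N M).card : ℝ) ≤ 6 ^ (N ^ d) * (2 * M + 1) ^ (2 ^ d) := by
          exact_mod_cast hcard
      _ ≤ Real.exp 2 ^ (N ^ d) * Real.exp (Real.log (2 * M + 1)) ^ (2 ^ d) := by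
          rw [Real.exp_log (by positivity)]
          gcongr
      _ = Real.exp (2 * (N : ℝ) ^ d + 2 ^ d * Real.log (2 * M + 1)) := by
          rw [← Real.exp_nat_mul, ← Real.exp_nat_mul, ← Real.exp_add]
          push_cast
          ring_nf
      _ ≤ Real.exp (2 * (15 * (1 / δ)) ^ d + 2 ^ d * (2 * K * (1 / δ) ^ d)) := by
          gcongr
      _ = _ := by
          rw [mul_pow]
          ring_nf
  · unfold codeSet
    rw [Fintype.mem_piFinset]
    intro k
    split_ifs with hk
    · exact secondDifference_quantizedEnv_mem hh hδ hk
    · simp only [secondDifference]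
      rw [dif_neg hk, Finset.mem_Icc]
      exact abs_le.1 (abs_quantizedEnv_le hh hδ (hgrid _ fun i => (k i).2))
  · have hq : ∀ k : Fin d → ℕ, (∀ i, k i < N) → quantizedEnv δ h k = quantizedEnv δ h' k :=
      eq_of_secondDifference_eq fun k hk => congrFun heq fun i => ⟨k i, hk i⟩
    have h1 := le_add_of_moreauEnv_le hh hh' hδ hδ1 hN13
      (fun k hk => moreauEnv_le_of_quantizedEnv_eq hδ (hq k hk)) hx
    have h2 := le_add_of_moreauEnv_le hh' hh hδ hδ1 hN13
      (fun k hk => moreauEnv_le_of_quantizedEnv_eq hδ (hq k hk).symm) hx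
    rw [abs_le]
    constructor <;> linarith

end Quantized

/-! ### Interior bounds from the integral, and rescaling. -/

/-- By Markov's inequality `|f| ≥ T` only on a set of measure at most `V / 4^(d+1)`. Three such sets
cannot cover a box of volume `V / 4^d`, so some `u` has `|f| ≤ T` at `x + u`, `x - u` and `x + 2u`.
Convexity gives `f x ≤ T` from the first two and `f x ≥ 2 f(x + u) - f(x + 2u) ≥ -3T`. -/
lemma abs_le_of_lintegral_le {d : ℕ} {p : ℝ} (hp : 1 ≤ p) {s l : Fin d → ℝ} (hl : ∀ i, 0 < l i)
    {f : (Fin d → ℝ) → ℝ} {B : ℝ} (hB : 0 < B)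
    (hc : ConvexOn ℝ (Set.Icc (s - l) (s + (2 : ℝ) • l)) f)
    (hint : ∫⁻ x in Set.Icc (s - l) (s + (2 : ℝ) • l), ENNReal.ofReal (|f x| ^ p) ≤
      ENNReal.ofReal (B ^ p))
    {x : Fin d → ℝ} (hx : ∀ i, s i - l i / 2 ≤ x i ∧ x i ≤ s i + 3 / 2 * l i) :
    |f x| ≤ 3 * 4 ^ (d + 1) * B * (∏ i, l i) ^ (-1 / p) := by
  set V := ∏ i, l i with hV
  have hV0 : 0 < V := Finset.prod_pos fun i _ => hl i
  have hp0 : 0 < p := by linarith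
  set T : ℝ := 4 ^ (d + 1) * B * V ^ (-1 / p) with hT
  have hT0 : 0 < T := by positivity
  set U : Set (Fin d → ℝ) := Set.univ.pi fun i => Set.Ioo (s i - l i) (s i + 2 * l i) with hU
  have hUo : IsOpen U := isOpen_set_pi Set.finite_univ fun i _ => isOpen_Ioo
  have hUI : U ⊆ Set.Icc (s - l) (s + (2 : ℝ) • l) := fun y hy =>
    ⟨fun i => (hy i trivial).1.le, fun i => (hy i trivial).2.le⟩
  have hcont : ContinuousOn f U := hc.continuousOn_interior.mono (interior_maximal hUI hUo)
  set S : Set (Fin d → ℝ) := {y | ENNReal.ofReal (T ^ p) ≤ ENNReal.ofReal (|f y| ^ p)} ∩ U with hS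
  have hmarkov : ENNReal.ofReal (T ^ p) * volume S ≤ ENNReal.ofReal (B ^ p) := by
    have hm : AEMeasurable (fun y => ENNReal.ofReal (|f y| ^ p)) (volume.restrict U) :=
      ((hcont.aemeasurable hUo.measurableSet).abs.pow_const p).ennreal_ofReal
    have h1 := mul_meas_ge_le_lintegral₀ hm (ENNReal.ofReal (T ^ p))
    rw [Measure.restrict_apply' hUo.measurableSet] at h1
    exact h1.trans ((lintegral_mono_set hUI).trans hint)
  set W : Set (Fin d → ℝ) := Set.univ.pi fun i => Set.Ioo (0 : ℝ) (l i / 4) with hW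
  have hWvol : volume W = ENNReal.ofReal (V / 4 ^ d) := by
    rw [hW, Real.volume_pi_Ioo, ← ENNReal.ofReal_prod_of_nonneg
      fun i _ => by linarith [hl i]]
    congr 1
    simp only [sub_zero, Finset.prod_div_distrib, Finset.prod_const, Finset.card_univ,
      Fintype.card_fin, hV]
  have hgood : ∃ u ∈ W, x + u ∉ S ∧ x - u ∉ S ∧ x + (2 : ℝ) • u ∉ S := by
    by_contra! hbad
    have hsub : W ⊆ ((fun u => x + u) ⁻¹' S ∪ (fun u => x - u) ⁻¹' S) ∪
        ((2 : ℝ) • ·) ⁻¹' ((fun u => x + u) ⁻¹' S) := by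
      intro u hu
      by_cases h1 : x + u ∈ S
      · exact Or.inl (Or.inl h1)
      · by_cases h2 : x - u ∈ S
        · exact Or.inl (Or.inr h2)
        · exact Or.inr (hbad u hu h1 h2)
    have hle : volume W ≤ 3 * volume S := by
      refine (measure_mono hsub).trans ((measure_union_le _ _).trans ?_)
      refine (add_le_add_left (measure_union_le _ _) _).trans ?_
      have e1 : volume ((fun u => x + u) ⁻¹' S) = volume S := measure_preimage_add _ _ _
      have e2 : volume ((fun u => x - u) ⁻¹' S) = volume S := by
        have : (fun u => x - u) ⁻¹' S = Neg.neg ⁻¹' ((fun u => x + u) ⁻¹' S) := by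
          ext u
          simp [sub_eq_add_neg]
        rw [this, Measure.measure_preimage_neg, e1]
      have e3 : volume (((2 : ℝ) • ·) ⁻¹' ((fun u => x + u) ⁻¹' S)) ≤ volume S := by
        rw [Measure.addHaar_preimage_smul _ (by norm_num), e1]
        refine mul_le_of_le_one_left zero_le (ENNReal.ofReal_le_one.2 ?_)
        rw [abs_of_pos (by positivity)]
        exact inv_le_one_of_one_le₀ (one_le_pow₀ (by norm_num))
      rw [e1, e2]
      calc volume S + volume S + _ ≤ volume S + volume S + volume S := by gcongr
        _ = 3 * volume S := by ring
    have h1 : ENNReal.ofReal (T ^ p * (V / 4 ^ d)) ≤ ENNReal.ofReal (3 * B ^ p) := by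
      rw [ENNReal.ofReal_mul (by positivity), ← hWvol, ENNReal.ofReal_mul (by norm_num)]
      calc _ ≤ ENNReal.ofReal (T ^ p) * (3 * volume S) := by gcongr
        _ = 3 * (ENNReal.ofReal (T ^ p) * volume S) := by ring
        _ ≤ _ := by
          rw [show ENNReal.ofReal 3 = 3 by norm_num]
          gcongr
    rw [ENNReal.ofReal_le_ofReal_iff (by positivity)] at h1
    have hTp : T ^ p = ((4 : ℝ) ^ (d + 1)) ^ p * B ^ p * V⁻¹ := by
      rw [hT, Real.mul_rpow (by positivity) (by positivity),
        Real.mul_rpow (by positivity) (by positivity), ← Real.rpow_mul hV0.le,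
        div_mul_cancel₀ _ hp0.ne', Real.rpow_neg_one]
    have h4 : (4 : ℝ) ^ (d + 1) ≤ ((4 : ℝ) ^ (d + 1)) ^ p :=
      Real.self_le_rpow_of_one_le (one_le_pow₀ (by norm_num)) hp
    have hBp : 0 < B ^ p := by positivity
    have h5 : T ^ p * (V / 4 ^ d) = ((4 : ℝ) ^ (d + 1)) ^ p / 4 ^ d * B ^ p := by
      rw [hTp]
      field_simp
    have h6 : 4 ≤ ((4 : ℝ) ^ (d + 1)) ^ p / 4 ^ d := by
      rw [le_div_iff₀ (by positivity), ← pow_succ']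
      exact h4
    rw [h5] at h1
    nlinarith
  have hnot : ∀ y ∈ U, y ∉ S → |f y| ≤ T := by
    intro y hyU hyS
    by_contra! hlt
    exact hyS ⟨ENNReal.ofReal_le_ofReal (Real.rpow_le_rpow hT0.le hlt.le hp0.le), hyU⟩
  obtain ⟨u, hu, h1, h2, h3⟩ := hgood
  have hu' : ∀ i, 0 < u i ∧ u i < l i / 4 := fun i => hu i trivial
  have m0 : x ∈ U := fun i _ => ⟨by linarith [hx i, hl i], by linarith [hx i, hl i]⟩
  have m1 : x + u ∈ U := fun i _ => by
    simp only [Pi.add_apply]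
    exact ⟨by linarith [hx i, hl i, hu' i], by linarith [hx i, hl i, hu' i]⟩
  have m2 : x - u ∈ U := fun i _ => by
    simp only [Pi.sub_apply]
    exact ⟨by linarith [hx i, hl i, hu' i], by linarith [hx i, hl i, hu' i]⟩
  have m3 : x + (2 : ℝ) • u ∈ U := fun i _ => by
    simp only [Pi.add_apply, Pi.smul_apply, smul_eq_mul]
    exact ⟨by linarith [hx i, hl i, hu' i], by linarith [hx i, hl i, hu' i]⟩
  have b1 := abs_le.1 (hnot _ m1 h1)
  have b2 := abs_le.1 (hnot _ m2 h2)
  have b3 := abs_le.1 (hnot _ m3 h3)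
  have c1 := hc.2 (hUI m1) (hUI m2) (by norm_num : (0 : ℝ) ≤ 1 / 2)
    (by norm_num : (0 : ℝ) ≤ 1 / 2) (by norm_num)
  have c2 := hc.2 (hUI m0) (hUI m3) (by norm_num : (0 : ℝ) ≤ 1 / 2)
    (by norm_num : (0 : ℝ) ≤ 1 / 2) (by norm_num)
  have e1 : (1 / 2 : ℝ) • (x + u) + (1 / 2 : ℝ) • (x - u) = x := by module
  have e2 : (1 / 2 : ℝ) • x + (1 / 2 : ℝ) • (x + (2 : ℝ) • u) = x + u := by module
  rw [e1, smul_eq_mul, smul_eq_mul] at c1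
  rw [e2, smul_eq_mul, smul_eq_mul] at c2
  have hfin : |f x| ≤ 3 * T := by
    rw [abs_le]
    constructor <;> linarith
  calc |f x| ≤ 3 * T := hfin
    _ = _ := by
      rw [hT]
      ring

/-- Rescaling a convex function near a box to the unit cube gives a normalized function. -/
lemma isNormalizedConvex_rescale {d : ℕ} {p : ℝ} (hp : 1 ≤ p) {s l : Fin d → ℝ}
    (hl : ∀ i, 0 < l i) {f : (Fin d → ℝ) → ℝ} {B : ℝ} (hB : 0 < B)
    (hc : ConvexOn ℝ (Set.Icc (s - l) (s + (2 : ℝ) • l)) f)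
    (hint : ∫⁻ x in Set.Icc (s - l) (s + (2 : ℝ) • l), ENNReal.ofReal (|f x| ^ p) ≤
      ENNReal.ofReal (B ^ p)) :
    IsNormalizedConvex fun t : Fin d → ℝ =>
      f (s + l * t) / (3 * 4 ^ (d + 1) * B * (∏ i, l i) ^ (-1 / p)) := by
  have hV0 : 0 < ∏ i, l i := Finset.prod_pos fun i _ => hl i
  set A := 3 * 4 ^ (d + 1) * B * (∏ i, l i) ^ (-1 / p) with hA
  have hA0 : 0 < A := by positivity
  have hbd : ∀ t ∈ Set.Icc (fun _ : Fin d => (-1 / 2 : ℝ)) (fun _ => 3 / 2), ∀ i,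
      s i - l i / 2 ≤ (s + l * t) i ∧ (s + l * t) i ≤ s i + 3 / 2 * l i := by
    intro t ht i
    have h1 := ht.1 i
    have h2 := ht.2 i
    have h3 := hl i
    simp only [Pi.add_apply, Pi.mul_apply]
    constructor <;> nlinarith
  have hU : ∀ t ∈ Set.Icc (fun _ : Fin d => (-1 / 2 : ℝ)) (fun _ => 3 / 2),
      s + l * t ∈ Set.univ.pi fun i => Set.Ioo (s i - l i) (s i + 2 * l i) :=
    fun t ht i _ => ⟨by linarith [hbd t ht i, hl i], by linarith [hbd t ht i, hl i]⟩
  have hUo : IsOpen (Set.univ.pi fun i => Set.Ioo (s i - l i) (s i + 2 * l i)) :=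
    isOpen_set_pi Set.finite_univ fun i _ => isOpen_Ioo
  have hUI : (Set.univ.pi fun i => Set.Ioo (s i - l i) (s i + 2 * l i)) ⊆
      Set.Icc (s - l) (s + (2 : ℝ) • l) := fun y hy =>
    ⟨fun i => (hy i trivial).1.le, fun i => (hy i trivial).2.le⟩
  refine ⟨⟨convex_Icc _ _, fun x hx y hy a b ha hb hab => ?_⟩, ?_, fun t ht => ?_⟩
  · have h1 := hc.2 (hUI (hU x hx)) (hUI (hU y hy)) ha hb hab
    have e1 : a • (s + l * x) + b • (s + l * y) = s + l * (a • x + b • y) := by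
      ext i
      simp only [Pi.add_apply, Pi.mul_apply, Pi.smul_apply, smul_eq_mul]
      linear_combination s i * hab
    rw [e1] at h1
    simp only [smul_eq_mul] at h1 ⊢
    rw [← mul_div_assoc, ← mul_div_assoc, ← add_div]
    exact div_le_div_of_nonneg_right h1 hA0.le
  · refine ContinuousOn.div_const ?_ _
    refine (hc.continuousOn_interior.mono (interior_maximal hUI hUo)).comp ?_ hU
    fun_prop
  · rw [abs_div, abs_of_pos hA0]
    exact div_le_one_of_le₀ (abs_le_of_lintegral_le hp hl hB hc hint (hbd t ht)) hA0.le

/-! ### From codes and local bounds to entropy in `L_p`. -/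

lemma eLpNorm_le_of_lintegral_le {d : ℕ} {p : ℝ} (hp : 1 ≤ p) {J : Set (Fin d → ℝ)}
    {f : (Fin d → ℝ) → ℝ} {ε : ℝ} (hε : 0 ≤ ε)
    (hf : ∫⁻ x in J, ENNReal.ofReal (|f x| ^ p) ≤ ENNReal.ofReal (ε ^ p)) :
    eLpNorm f (ENNReal.ofReal p) (volume.restrict J) ≤ ENNReal.ofReal ε := by
  have hp0 : 0 < p := by linarith
  rw [eLpNorm_eq_lintegral_rpow_enorm_toReal (by simpa using hp0) ENNReal.ofReal_ne_top,
    ENNReal.toReal_ofReal hp0.le]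
  have h1 : ∀ x, ‖f x‖ₑ ^ p = ENNReal.ofReal (|f x| ^ p) := fun x => by
    rw [Real.enorm_eq_ofReal_abs, ENNReal.ofReal_rpow_of_nonneg (abs_nonneg _) hp0.le]
  simp only [h1]
  calc _ ≤ ENNReal.ofReal (ε ^ p) ^ (1 / p) := by gcongr
    _ = ENNReal.ofReal ε := by
      rw [← ENNReal.ofReal_rpow_of_nonneg hε hp0.le, ← ENNReal.rpow_mul,
        mul_one_div_cancel hp0.ne', ENNReal.rpow_one]

lemma eLpNorm_sub_le_of_boxes {d : ℕ} {p : ℝ} (hp : 1 ≤ p) {J : Set (Fin d → ℝ)} {ι : Type*}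
    [Fintype ι] {s l : ι → Fin d → ℝ} (hl : ∀ j i, 0 < l j i)
    (hJ : J ⊆ ⋃ j, Set.Icc (s j) (s j + l j)) {f g : (Fin d → ℝ) → ℝ} {r : ι → ℝ}
    (hfg : ∀ j, ∀ x ∈ Set.Icc (s j) (s j + l j), |f x - g x| ≤ r j)
    {ε : ℝ} (hε : 0 ≤ ε) (hr : ∑ j, r j ^ p * ∏ i, l j i ≤ ε ^ p) :
    eLpNorm (f - g) (ENNReal.ofReal p) (volume.restrict J) ≤ ENNReal.ofReal ε := by
  have hp0 : 0 < p := by linarith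
  have hr0 : ∀ j, 0 ≤ r j := fun j => (abs_nonneg _).trans (hfg j (s j)
    ⟨le_rfl, le_add_of_nonneg_right fun i => (hl j i).le⟩)
  refine eLpNorm_le_of_lintegral_le hp hε ?_
  calc ∫⁻ x in J, ENNReal.ofReal (|(f - g) x| ^ p)
      ≤ ∫⁻ x in ⋃ j, Set.Icc (s j) (s j + l j), ENNReal.ofReal (|(f - g) x| ^ p) :=
        lintegral_mono_set hJ
    _ ≤ ∑' j, ∫⁻ x in Set.Icc (s j) (s j + l j), ENNReal.ofReal (|(f - g) x| ^ p) :=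
        lintegral_iUnion_le _ _
    _ = ∑ j, ∫⁻ x in Set.Icc (s j) (s j + l j), ENNReal.ofReal (|(f - g) x| ^ p) :=
        tsum_fintype _
    _ ≤ ∑ j, ENNReal.ofReal (r j ^ p * ∏ i, l j i) := by
        refine Finset.sum_le_sum fun j _ => ?_
        calc _ ≤ ∫⁻ _x in Set.Icc (s j) (s j + l j), ENNReal.ofReal (r j ^ p) := by
              refine setLIntegral_mono measurable_const fun x hx => ?_
              exact ENNReal.ofReal_le_ofReal
                (Real.rpow_le_rpow (abs_nonneg _) (hfg j x hx) hp0.le)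
          _ = _ := by
              rw [setLIntegral_const, Real.volume_Icc_pi, ← ENNReal.ofReal_prod_of_nonneg
                fun i _ => by simpa using (hl j i).le,
                ← ENNReal.ofReal_mul (Real.rpow_nonneg (hr0 j) p)]
              simp
    _ = ENNReal.ofReal (∑ j, r j ^ p * ∏ i, l j i) :=
        (ENNReal.ofReal_sum_of_nonneg fun j _ => mul_nonneg (Real.rpow_nonneg (hr0 j) p)
          (Finset.prod_nonneg fun i _ => (hl j i).le)).symm
    _ ≤ ENNReal.ofReal (ε ^ p) := ENNReal.ofReal_le_ofReal hr

lemma lpMetricEntropy_le_of_encard_le {d : ℕ} {F : Set ((Fin d → ℝ) → ℝ)} {ε p : ℝ}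
    {J : Set (Fin d → ℝ)} {C : Set ((Fin d → ℝ) → ℝ)} (hC : IsLpCover p J F ε C) {n : ℕ}
    (hn : C.encard ≤ n) {X : ℝ} (hX : (n : ℝ) ≤ Real.exp X) :
    lpMetricEntropy F ε p J ≤ (X : EReal) := by
  have h1 : lpCoveringNumber F ε p J ≤ n := (iInf₂_le C hC).trans hn
  unfold lpMetricEntropy
  calc ENNReal.log (lpCoveringNumber F ε p J : ℝ≥0∞) ≤ ENNReal.log ((n : ℕ∞) : ℝ≥0∞) :=
        ENNReal.log_le_log (by exact_mod_cast h1)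
    _ ≤ ENNReal.log (ENNReal.ofReal (Real.exp X)) := by
        refine ENNReal.log_le_log ?_
        rw [ENat.toENNReal_coe, ← ENNReal.ofReal_natCast]
        exact ENNReal.ofReal_le_ofReal hX
    _ = X := by rw [ENNReal.log_ofReal_of_pos (Real.exp_pos X), Real.log_exp]

/-- A code that determines the members of a class up to `ε` bounds the entropy of the class. -/
lemma lpMetricEntropy_le_of_code {d : ℕ} {F : Set ((Fin d → ℝ) → ℝ)} {ε p : ℝ}
    {J : Set (Fin d → ℝ)} (hF : ∀ f ∈ F, MemLp f (ENNReal.ofReal p) (volume.restrict J))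
    {γ : Type*} (T : Finset γ) (code : ((Fin d → ℝ) → ℝ) → γ) (hT : ∀ f ∈ F, code f ∈ T)
    (hcode : ∀ f ∈ F, ∀ g ∈ F, code f = code g →
      eLpNorm (f - g) (ENNReal.ofReal p) (volume.restrict J) ≤ ENNReal.ofReal ε)
    {X : ℝ} (hX : (T.card : ℝ) ≤ Real.exp X) :
    lpMetricEntropy F ε p J ≤ (X : EReal) := by
  classical
  -- Centres are taken from the class itself, one per attained code; the value `0` at other codes
  -- never enters the net.
  have hrep : ∀ t : γ, ∃ g, (∃ f ∈ F, code f = t) → g ∈ F ∧ code g = t := by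
    intro t
    by_cases ht : ∃ f ∈ F, code f = t
    · obtain ⟨f, hf, rfl⟩ := ht
      exact ⟨f, fun _ => ⟨hf, rfl⟩⟩
    · exact ⟨0, fun h => absurd h ht⟩
  choose rep hrep using hrep
  refine lpMetricEntropy_le_of_encard_le (C := rep '' {t | t ∈ T ∧ ∃ f ∈ F, code f = t})
    ⟨?_, fun f hf => ?_⟩ ?_ hX
  · rintro _ ⟨t, ⟨-, ht⟩, rfl⟩
    exact hF _ (hrep t ht).1
  · have hex : ∃ g ∈ F, code g = code f := ⟨f, hf, rfl⟩
    exact ⟨rep (code f), ⟨code f, ⟨hT f hf, hex⟩, rfl⟩,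
      hcode f hf _ (hrep _ hex).1 (hrep _ hex).2.symm⟩
  · refine (Set.encard_image_le _ _).trans ?_
    rw [← Set.encard_coe_eq_coe_finsetCard]
    exact Set.encard_le_encard fun t ht => ht.1

lemma memLp_of_mem_convexClass {d : ℕ} {p : ℝ} (hp : 1 ≤ p) {a b α β : Fin d → ℝ}
    (hab : ∀ i, a i < α i ∧ α i < β i ∧ β i < b i) {B : ℝ} (hB : 0 < B)
    {f : (Fin d → ℝ) → ℝ} (hf : f ∈ convexClass p (Set.Icc a b) B) :
    MemLp f (ENNReal.ofReal p) (volume.restrict (Set.Icc α β)) ∧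
      eLpNorm f (ENNReal.ofReal p) (volume.restrict (Set.Icc α β)) ≤ ENNReal.ofReal B := by
  have hUo : IsOpen (Set.univ.pi fun i => Set.Ioo (a i) (b i)) :=
    isOpen_set_pi Set.finite_univ fun i _ => isOpen_Ioo
  have hUI : (Set.univ.pi fun i => Set.Ioo (a i) (b i)) ⊆ Set.Icc a b := fun y hy =>
    ⟨fun i => (hy i trivial).1.le, fun i => (hy i trivial).2.le⟩
  have hJU : Set.Icc α β ⊆ Set.univ.pi fun i => Set.Ioo (a i) (b i) := fun y hy i _ =>
    ⟨(hab i).1.trans_le (hy.1 i), (hy.2 i).trans_lt (hab i).2.2⟩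
  have hcont : ContinuousOn f (Set.Icc α β) :=
    hf.1.continuousOn_interior.mono (hJU.trans (interior_maximal hUI hUo))
  have hle : eLpNorm f (ENNReal.ofReal p) (volume.restrict (Set.Icc α β)) ≤ ENNReal.ofReal B :=
    eLpNorm_le_of_lintegral_le hp hB.le ((lintegral_mono_set (hJU.trans hUI)).trans hf.2)
  exact ⟨⟨hcont.aestronglyMeasurable measurableSet_Icc, hle.trans_lt ENNReal.ofReal_lt_top⟩, hle⟩

/-! ### Dyadic boxes accumulating at the boundary. -/

/-- The length of the dyadic subintervals of `[a, b]` at level `k`. -/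
noncomputable def dyadicLength (a b : ℝ) (k : ℕ) : ℝ := (b - a) * (1 / 2) ^ (k + 2)

/-- The left end of the dyadic subinterval of `[a, b]` at level `k` near `a` or near `b`. -/
noncomputable def dyadicStart (a b : ℝ) (k : ℕ) (right : Bool) : ℝ :=
  if right then b - 2 * dyadicLength a b k else a + dyadicLength a b k

lemma dyadicLength_pos {a b : ℝ} (hab : a < b) (k : ℕ) : 0 < dyadicLength a b k :=
  mul_pos (sub_pos.2 hab) (by positivity)

/-- Each interval is one length away from its nearer endpoint, and three lengths are at most `3/4`
of `b - a`. -/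
lemma dyadic_enlarged_mem {a b : ℝ} (hab : a < b) (k : ℕ) (right : Bool) :
    a ≤ dyadicStart a b k right - dyadicLength a b k ∧
      dyadicStart a b k right + 2 * dyadicLength a b k ≤ b := by
  have h0 := dyadicLength_pos hab k
  have h1 : dyadicLength a b k ≤ (b - a) * (1 / 4) := by
    refine mul_le_mul_of_nonneg_left ?_ (sub_pos.2 hab).le
    rw [pow_add]
    have : (1 / 2 : ℝ) ^ k ≤ 1 := pow_le_one₀ (by norm_num) (by norm_num)
    linarith
  cases right <;> simp only [dyadicStart] <;> constructor <;> norm_num <;> linarith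

lemma exists_dyadic_level {t η : ℝ} {m : ℕ} (hη : 0 < η) (hm : (1 / 2 : ℝ) ^ m ≤ η) (ht : η ≤ t)
    (ht' : t ≤ 1 / 2) :
    ∃ k < m, (1 / 2 : ℝ) ^ (k + 2) ≤ t ∧ t ≤ 2 * (1 / 2) ^ (k + 2) := by
  -- Applied to `2 * t`, so that level `0` covers relative distances from `1/4` to `1/2`, and `k ≥
  -- m` would give `2 * t ≤ η ≤ t`.
  obtain ⟨k, hk1, hk2⟩ := exists_nat_pow_near_of_lt_one (x := 2 * t) (y := (1 / 2 : ℝ))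
    (by linarith) (by linarith) (by norm_num) (by norm_num)
  refine ⟨k, ?_, ?_, ?_⟩
  · by_contra! hmk
    have : (1 / 2 : ℝ) ^ k ≤ (1 / 2) ^ m :=
      pow_le_pow_of_le_one (by norm_num) (by norm_num) hmk
    linarith
  · rw [pow_succ] at hk1
    rw [pow_add]
    linarith
  · rw [pow_add]
    linarith

lemma exists_dyadic_mem {a b x η : ℝ} (hab : a < b) {m : ℕ} (hη : 0 < η)
    (hm : (1 / 2 : ℝ) ^ m ≤ η) (hxa : η * (b - a) ≤ x - a) (hxb : η * (b - a) ≤ b - x) :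
    ∃ q : Fin m × Bool, dyadicStart a b q.1 q.2 ≤ x ∧
      x ≤ dyadicStart a b q.1 q.2 + dyadicLength a b q.1 := by
  have hba : 0 < b - a := sub_pos.2 hab
  rcases le_total (x - a) (b - x) with hx | hx
  · obtain ⟨k, hk, h1, h2⟩ := exists_dyadic_level (t := (x - a) / (b - a)) hη hm
      (by rwa [le_div_iff₀ hba]) (by rw [div_le_iff₀ hba]; linarith)
    rw [le_div_iff₀ hba] at h1
    rw [div_le_iff₀ hba] at h2
    refine ⟨(⟨k, hk⟩, false), ?_, ?_⟩ <;> simp only [dyadicStart, dyadicLength] <;> norm_num <;>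
      norm_num at h1 h2 <;> linarith
  · obtain ⟨k, hk, h1, h2⟩ := exists_dyadic_level (t := (b - x) / (b - a)) hη hm
      (by rwa [le_div_iff₀ hba]) (by rw [div_le_iff₀ hba]; linarith)
    rw [le_div_iff₀ hba] at h1
    rw [div_le_iff₀ hba] at h2
    refine ⟨(⟨k, hk⟩, true), ?_, ?_⟩ <;> simp only [dyadicStart, dyadicLength] <;> norm_num <;>
      norm_num at h1 h2 <;> linarith

section RelDist

variable {d : ℕ} {a b α β : Fin d → ℝ}

lemma relDist_le (i : Fin d) :
    relDist a b α β ≤ min ((α i - a i) / (b i - a i)) ((b i - β i) / (b i - a i)) :=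
  ciInf_le (Set.finite_range _).bddBelow i

lemma relDist_pos (hd : 1 ≤ d) (hab : ∀ i, a i < α i ∧ α i < β i ∧ β i < b i) :
    0 < relDist a b α β := by
  have : Nonempty (Fin d) := ⟨⟨0, hd⟩⟩
  obtain ⟨i, hi⟩ := exists_eq_ciInf_of_finite
    (f := fun i => min ((α i - a i) / (b i - a i)) ((b i - β i) / (b i - a i)))
  unfold relDist
  rw [← hi]
  obtain ⟨h1, h2, h3⟩ := hab i
  exact lt_min (div_pos (by linarith) (by linarith)) (div_pos (by linarith) (by linarith))

lemma relDist_le_half (hd : 1 ≤ d) (hab : ∀ i, a i < α i ∧ α i < β i ∧ β i < b i) :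
    relDist a b α β ≤ 1 / 2 := by
  have h := relDist_le (a := a) (b := b) (α := α) (β := β) ⟨0, hd⟩
  obtain ⟨h1, h2, h3⟩ := hab ⟨0, hd⟩
  have hba : 0 < b ⟨0, hd⟩ - a ⟨0, hd⟩ := by linarith
  have h4 := h.trans (min_le_left _ _)
  have h5 := h.trans (min_le_right _ _)
  rw [le_div_iff₀ hba] at h4 h5
  by_contra! hlt
  nlinarith

end RelDist

lemma exists_dyadic_depth {η : ℝ} (hη : 0 < η) (hη2 : η ≤ 1 / 2) :
    ∃ m : ℕ, 0 < m ∧ (1 / 2 : ℝ) ^ m ≤ η ∧ (2 * m : ℝ) ≤ 6 * Real.log (1 / η) := by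
  have hlog2 := Real.log_two_gt_d9
  have h1 : Real.log 2 ≤ Real.log (1 / η) := by
    refine Real.log_le_log (by norm_num) ?_
    rw [le_div_iff₀ hη]
    linarith
  have h2 : 0 < Real.log (1 / η) / Real.log 2 := div_pos (by linarith) (by linarith)
  refine ⟨⌈Real.log (1 / η) / Real.log 2⌉₊, Nat.ceil_pos.2 h2, ?_, ?_⟩
  · have h3 := Nat.le_ceil (Real.log (1 / η) / Real.log 2)
    rw [div_le_iff₀ (by linarith), ← Real.log_pow] at h3
    have h4 := (Real.log_le_log_iff (by positivity) (by positivity)).1 h3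
    rw [one_div_pow]
    rwa [one_div_le (by positivity) hη]
  · have h3 := (Nat.ceil_lt_add_one h2.le).le
    -- As `log (1/η) ≥ log 2`, the left side is at most `2 / log 2 < 3` times `log (1/η)`.
    have h4 : Real.log (1 / η) / Real.log 2 + 1 ≤ 3 * Real.log (1 / η) := by
      rw [div_add_one (by linarith), div_le_iff₀ (by linarith)]
      nlinarith
    linarith

/-! ### Assembling the boxes. -/

/-- The entropy bound in terms of a cover by boxes whose enlargements stay inside the domain. -/
lemma lpMetricEntropy_le_of_boxes {d : ℕ} {p : ℝ} (hp : 1 ≤ p) {C : ℝ}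
    (hC : ∀ δ : ℝ, 0 < δ → δ ≤ 1 →
      ∃ (γ : Type) (T : Finset γ) (code : ((Fin d → ℝ) → ℝ) → γ),
      (T.card : ℝ) ≤ Real.exp (C * (1 / δ) ^ d) ∧
      (∀ h, IsNormalizedConvex h → code h ∈ T) ∧
      ∀ h h', IsNormalizedConvex h → IsNormalizedConvex h' → code h = code h' →
        ∀ x ∈ Set.Icc (0 : Fin d → ℝ) 1, |h x - h' x| ≤ (d + 2) * δ ^ 2)
    {a b α β : Fin d → ℝ} (hab : ∀ i, a i < α i ∧ α i < β i ∧ β i < b i)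
    {ι : Type} [Fintype ι] [Nonempty ι] {s l : ι → Fin d → ℝ} (hl : ∀ j i, 0 < l j i)
    (hsub : ∀ j, Set.Icc (s j - l j) (s j + (2 : ℝ) • l j) ⊆ Set.Icc a b)
    (hJ : Set.Icc α β ⊆ ⋃ j, Set.Icc (s j) (s j + l j))
    {B ε : ℝ} (hB : 0 < B) (hε : 0 < ε) (hεB : ε ≤ B) :
    lpMetricEntropy (convexClass p (Set.Icc a b) B) ε p (Set.Icc α β) ≤
      ((Fintype.card ι * (C * ((ε / B) * (Fintype.card ι : ℝ) ^ (-1 / p) /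
        (3 * 4 ^ (d + 1) * (d + 2))) ^ (-(d : ℝ) / 2)) : ℝ) : EReal) := by
  classical
  have hp0 : 0 < p := by linarith
  set n : ℝ := (Fintype.card ι : ℝ) with hn
  have hn1 : 1 ≤ n := by
    rw [hn]
    exact_mod_cast Fintype.card_pos (α := ι)
  have hn0 : 0 < n := by linarith
  set D : ℝ := 3 * 4 ^ (d + 1) with hD
  have hD1 : 1 ≤ D := by
    have : (1 : ℝ) ≤ 4 ^ (d + 1) := one_le_pow₀ (by norm_num)
    linarith
  -- With `δ ^ 2 = τ`, the error on box `j` is `A j * (d + 2) * τ = ε * (n * V j)^(-1/p)`, where `V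
  -- j` is its volume, so each box contributes exactly `ε ^ p / n`.
  set τ : ℝ := (ε / B) * n ^ (-1 / p) / (D * (d + 2)) with hτ
  have hτ0 : 0 < τ := by positivity
  have hτ1 : τ ≤ 1 := by
    refine div_le_one_of_le₀ ?_ (by positivity)
    have h1 : ε / B ≤ 1 := div_le_one_of_le₀ hεB hB.le
    have h2 : n ^ (-1 / p) ≤ 1 := Real.rpow_le_one_of_one_le_of_nonpos hn1
      (div_nonpos_of_nonpos_of_nonneg (by norm_num) hp0.le)
    have h3 : ε / B * n ^ (-1 / p) ≤ 1 := mul_le_one₀ h1 (by positivity) h2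
    have h4 : (0 : ℝ) ≤ d := Nat.cast_nonneg d
    nlinarith
  obtain ⟨γ, T, code, hcard, hmem, hcode⟩ := hC (Real.sqrt τ) (Real.sqrt_pos.2 hτ0)
    (Real.sqrt_le_one.2 hτ1)
  rw [Real.sq_sqrt hτ0.le] at hcode
  set A : ι → ℝ := fun j => D * B * (∏ i, l j i) ^ (-1 / p) with hA
  have hV0 : ∀ j, 0 < ∏ i, l j i := fun j => Finset.prod_pos fun i _ => hl j i
  have hA0 : ∀ j, 0 < A j := fun j => by
    have := hV0 j
    positivity
  set resc : ((Fin d → ℝ) → ℝ) → ι → (Fin d → ℝ) → ℝ :=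
    fun f j t => f (s j + l j * t) / A j with hresc
  have hnorm : ∀ f ∈ convexClass p (Set.Icc a b) B, ∀ j, IsNormalizedConvex (resc f j) :=
    fun f hf j => isNormalizedConvex_rescale hp (hl j) hB (hf.1.subset (hsub j) (convex_Icc _ _))
      ((lintegral_mono_set (hsub j)).trans hf.2)
  refine lpMetricEntropy_le_of_code (fun f hf => (memLp_of_mem_convexClass hp hab hB hf).1)
    (Fintype.piFinset fun _ : ι => T) (fun f j => code (resc f j))
    (fun f hf => Fintype.mem_piFinset.2 fun j => hmem _ (hnorm f hf j))
    (fun f hf g hg hfg => ?_) ?_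
  · refine eLpNorm_sub_le_of_boxes hp hl hJ (r := fun j => A j * ((d + 2) * τ))
      (fun j x hx => ?_) hε.le (le_of_eq ?_)
    · have hne : ∀ i, l j i ≠ 0 := fun i => (hl j i).ne'
      have ht : (fun i => (x i - s j i) / l j i) ∈ Set.Icc (0 : Fin d → ℝ) 1 := by
        constructor <;> intro i
        · exact div_nonneg (sub_nonneg.2 (hx.1 i)) (hl j i).le
        · refine div_le_one_of_le₀ ?_ (hl j i).le
          have := hx.2 i
          simp only [Pi.add_apply] at this
          linarith
      have h1 := hcode _ _ (hnorm f hf j) (hnorm g hg j) (congrFun hfg j) _ ht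
      have hxe : s j + l j * (fun i => (x i - s j i) / l j i) = x := by
        ext i
        simp only [Pi.add_apply, Pi.mul_apply]
        rw [mul_div_cancel₀ _ (hne i)]
        ring
      simp only [hresc, hxe] at h1
      rw [← sub_div, abs_div, abs_of_pos (hA0 j), div_le_iff₀ (hA0 j)] at h1
      linarith
    · have hterm : ∀ j, (A j * ((d + 2) * τ)) ^ p * ∏ i, l j i = ε ^ p * n⁻¹ := by
        intro j
        have hV := hV0 j
        have e1 : A j * ((d + 2) * τ) = ε * n ^ (-1 / p) * (∏ i, l j i) ^ (-1 / p) := by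
          simp only [hA, hτ]
          field_simp
        rw [e1, Real.mul_rpow (by positivity) (by positivity),
          Real.mul_rpow (by positivity) (by positivity), ← Real.rpow_mul hV.le,
          ← Real.rpow_mul hn0.le, div_mul_cancel₀ _ hp0.ne', Real.rpow_neg_one,
          Real.rpow_neg_one, mul_assoc, inv_mul_cancel₀ hV.ne', mul_one]
      rw [Finset.sum_congr rfl fun j _ => hterm j, Finset.sum_const, Finset.card_univ,
        nsmul_eq_mul, ← hn]
      field_simp
  · rw [Fintype.card_piFinset, Finset.prod_const, Finset.card_univ, Nat.cast_pow, hn,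
      Real.exp_nat_mul]
    refine pow_le_pow_left₀ (Nat.cast_nonneg _) (hcard.trans (le_of_eq ?_)) _
    congr 2
    rw [neg_div, Real.rpow_neg hτ0.le, ← inv_eq_one_div, inv_pow, ← Real.rpow_natCast,
      Real.sqrt_eq_rpow, ← Real.rpow_mul hτ0.le]
    congr 2
    ring

theorem theorem4 (d : ℕ) (hd : 1 ≤ d) (p : ℝ) (hp : 1 ≤ p) :
    ∃ c : ℝ, 0 < c ∧
      ∀ a b α β : Fin d → ℝ, (∀ i, a i < α i ∧ α i < β i ∧ β i < b i) →
      ∀ B : ℝ, 0 < B → ∀ ε : ℝ, 0 < ε →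
        lpMetricEntropy (convexClass p (Set.Icc a b) B) ε p (Set.Icc α β) ≤
          ((c * (ε / B) ^ (-(d : ℝ) / 2) *
            Real.log (1 / relDist a b α β) ^ ((d : ℝ) * (2 * p + d) / (2 * p)) : ℝ) : EReal) := by
  obtain ⟨C, hC0, hC⟩ := exists_convex_code hd
  have hp0 : 0 < p := by linarith
  set D : ℝ := 3 * 4 ^ (d + 1) * (d + 2) with hD
  have hD0 : 0 < D := by positivity
  set e : ℝ := (d : ℝ) * (2 * p + d) / (2 * p) with he
  have he0 : 0 ≤ e := by positivity
  -- `D ^ (d/2)` comes from the denominator of the box accuracy and `6 ^ e` from `2 * m ≤ 6 * log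
  -- (1/η)`.
  refine ⟨C * D ^ ((d : ℝ) / 2) * 6 ^ e, by positivity, fun a b α β hab B hB ε hε => ?_⟩
  set η := relDist a b α β with hη
  have hη0 : 0 < η := relDist_pos hd hab
  have hη2 : η ≤ 1 / 2 := relDist_le_half hd hab
  have hL0 : 0 < Real.log (1 / η) := Real.log_pos (by rw [lt_div_iff₀ hη0]; linarith)
  -- For `B ≤ ε` the zero function alone is a net; otherwise `ε ≤ B` ensures `δ ≤ 1`.
  rcases le_total B ε with hBε | hεB
  · refine lpMetricEntropy_le_of_encard_le (C := {0}) (n := 1) ⟨?_, fun f hf => ⟨0, rfl, ?_⟩⟩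
      (by simp) ?_
    · rintro _ rfl
      exact MemLp.zero
    · rw [sub_zero]
      exact (memLp_of_mem_convexClass hp hab hB hf).2.trans (ENNReal.ofReal_le_ofReal hBε)
    · rw [Nat.cast_one]
      exact Real.one_le_exp (by positivity)
  · obtain ⟨m, hm0, hmη, hm6⟩ := exists_dyadic_depth hη0 hη2
    have hlt : ∀ i, a i < b i := fun i => by linarith [hab i]
    have : Nonempty (Fin m × Bool) := ⟨(⟨0, hm0⟩, true)⟩
    have hmain := lpMetricEntropy_le_of_boxes (ι := Fin d → Fin m × Bool) hp hC hab
      (s := fun j i => dyadicStart (a i) (b i) (j i).1 (j i).2)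
      (l := fun j i => dyadicLength (a i) (b i) (j i).1)
      (fun j i => dyadicLength_pos (hlt i) _)
      (fun j => Set.Icc_subset_Icc (fun i => (dyadic_enlarged_mem (hlt i) _ _).1)
        (fun i => (dyadic_enlarged_mem (hlt i) _ _).2))
      (fun x hx => by
        have hex : ∀ i, ∃ q : Fin m × Bool, dyadicStart (a i) (b i) q.1 q.2 ≤ x i ∧
            x i ≤ dyadicStart (a i) (b i) q.1 q.2 + dyadicLength (a i) (b i) q.1 := by
          intro i
          have h1 := relDist_le (a := a) (b := b) (α := α) (β := β) i
          have hba := sub_pos.2 (hlt i)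
          have h2 := h1.trans (min_le_left _ _)
          have h3 := h1.trans (min_le_right _ _)
          rw [le_div_iff₀ hba] at h2 h3
          exact exists_dyadic_mem (hlt i) hη0 hmη (by linarith [hx.1 i]) (by linarith [hx.2 i])
        choose j hj using hex
        exact Set.mem_iUnion.2 ⟨j, fun i => (hj i).1, fun i => (hj i).2⟩)
      hB hε hεB
    refine hmain.trans (EReal.coe_le_coe_iff.2 ?_)
    have hM0 : (0 : ℝ) < 2 * m := by positivity
    have hcard : (Fintype.card (Fin d → Fin m × Bool) : ℝ) = (2 * m : ℝ) ^ (d : ℝ) := by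
      rw [Real.rpow_natCast]
      simp only [Fintype.card_fun, Fintype.card_prod, Fintype.card_fin, Fintype.card_bool]
      push_cast
      rw [mul_comm]
    rw [hcard, ← hD]
    have hεB0 : 0 < ε / B := by positivity
    -- The number of boxes enters as a factor and through the accuracy on each: `d + d * d / (2p) =
    -- e`.
    have hpow : (2 * m : ℝ) ^ (d : ℝ) * (((2 * m : ℝ) ^ (d : ℝ)) ^ (-1 / p)) ^ (-(d : ℝ) / 2) =
        (2 * m : ℝ) ^ e := by
      rw [← Real.rpow_mul hM0.le, ← Real.rpow_mul hM0.le, ← Real.rpow_add hM0]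
      congr 1
      rw [he]
      field_simp
    rw [Real.div_rpow (by positivity) hD0.le, Real.mul_rpow hεB0.le (by positivity), neg_div,
      Real.rpow_neg hD0.le, div_inv_eq_mul, ← neg_div]
    calc _ = C * D ^ ((d : ℝ) / 2) * (ε / B) ^ (-(d : ℝ) / 2) * ((2 * m : ℝ) ^ (d : ℝ) *
          (((2 * m : ℝ) ^ (d : ℝ)) ^ (-1 / p)) ^ (-(d : ℝ) / 2)) := by ring
      _ ≤ C * D ^ ((d : ℝ) / 2) * (ε / B) ^ (-(d : ℝ) / 2) * (6 * Real.log (1 / η)) ^ e := by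
          rw [hpow]
          gcongr
      _ = _ := by
          rw [Real.mul_rpow (by norm_num) hL0.le]
          ring
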